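/- **Definitions.** Let $k$ be a field, $A$ a set and $f=(f_e\mid e\in E)$ a family of functions $A\to k$. A *thin dependence* of $f$ is a family $\lambda=(\lambda_e\mid e\in E)$ in $k$ such that for every $a\in A$ only finitely many $e\in E$ satisfy $\lambda_e f_e(a)\neq 0$, and $\sum_{e\in E}\lambda_e f_e(a)=0$. A set $I\subseteq E$ is *thinly independent* for $f$ if the only thin dependence of $f$ that vanishes outside $I$ is $0$. A (possibly infinite) matroid on $E$ is a *thin sums matroid over $k$* if, for some set $A$ and some such family $f$, its independent sets are exactly the thinly independent subsets of $E$; it is a *thin sums matroid* if it is one over some field. If $M$ is a matroid whose ground set $E$ is not a base, $M^+$ is the matroid on $E$ whose bases are the sets $B\cup\{e\}$ with $B$ a base of $M$ and $e\in E\setminus B$. The *algebraic cycle matroid* of a graph $G$ (when it exists) is the matroid on the edge set of $G$ whose circuits are the edge sets of the finite cycles of $G$ (a loop counts as a cycle) and of the double rays (two-sided infinite paths) of $G$. **Theorem 1.3.** There exists a thin sums matroid whose dual is not a thin sums matroid. More precisely, let $G$ be the graph with vertices $u_i, w_i$ ($i\in\mathbb N=\{0,1,2,\dots\}$) and $*$,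 and with edges $p_i$ joining $u_i$ to $u_{i+1}$, $q_i$ joining $w_i$ to $w_{i+1}$, $r_i$ joining $u_i$ to $w_i$ ($i\in\mathbb N$), and a loop $l$ at $*$; that is, $G$ is the disjoint union of the one-sided infinite ladder and a loop. Then the algebraic cycle matroid $M$ of $G$ exists, its ground set is not a base, $M^+$ exists and is a thin sums matroid over $\mathbb Q$, and the dual $(M^+)^*$ is not a thin sums matroid over any field. -/

import Mathlib

universe w u x

/-! ### Thin sums matroids -/

/-- The family `c` of scalars is a thin dependence of the family `f` of functions `A → k`: for each
`a`, only finitely many of the products `c e * f e a` are nonzero, and they sum to zero. -/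
def IsThinDependence {ι A k : Type*} [Field k] (f : ι → A → k) (c : ι → k) : Prop :=
  ∀ a : A, {e : ι | c e * f e a ≠ 0}.Finite ∧ ∑ᶠ e : ι, c e * f e a = 0

/-- `I` is thinly independent for `f`: the only thin dependence of `f` vanishing outside `I` is the
zero family. -/
def ThinlyIndependent {ι A k : Type*} [Field k] (f : ι → A → k) (I : Set ι) : Prop :=
  ∀ c : ι → k, IsThinDependence f c → (∀ e, e ∉ I → c e = 0) → ∀ e, c e = 0

/-- `M` is a thin sums matroid over the field `k`: its independent sets are exactly the thinly
independent subsets of its ground set, for some family of functions from a set `A` to `k`.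
The family is written with the ambient type as index type; since only subsets of the ground set are
tested, its values outside the ground set play no role. -/
def IsThinSumsOver {E : Type x} (k : Type u) [Field k] (M : Matroid E) : Prop :=
  ∃ (A : Type w) (f : E → A → k), ∀ I : Set E, I ⊆ M.E → (M.Indep I ↔ ThinlyIndependent f I)

/-- `M` is a thin sums matroid (over some field). -/
def IsThinSums {E : Type x} (M : Matroid E) : Prop :=
  ∃ (k : Type u) (_ : Field k), IsThinSumsOver.{w} k M

/-! ### Algebraic cycle matroids -/

/-- `C` is the edge set of a finite cycle of the multigraph `G` (a loop is a cycle of length one,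
two parallel edges form a cycle of length two). -/
def Graph.IsFiniteCycleEdgeSet {V E : Type*} (G : Graph V E) (C : Set E) : Prop :=
  ∃ n : ℕ, 0 < n ∧ ∃ (v : ZMod n → V) (e : ZMod n → E),
    Function.Injective v ∧ Function.Injective e ∧
      (∀ i, G.IsLink (e i) (v i) (v (i + 1))) ∧ C = Set.range e

/-- `C` is the edge set of a double ray (two sided infinite path) of the multigraph `G`. -/
def Graph.IsDoubleRayEdgeSet {V E : Type*} (G : Graph V E) (C : Set E) : Prop :=
  ∃ (v : ℤ → V) (e : ℤ → E),
    Function.Injective v ∧ (∀ i, G.IsLink (e i) (v i) (v (i + 1))) ∧ C = Set.range e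

/-- `M` is the algebraic cycle matroid of `G`: its ground set is the edge set of `G` and its
circuits are the edge sets of finite cycles and of double rays.  A matroid is determined by its
ground set and circuits, so there is at most one such `M`. -/
def Graph.IsAlgebraicCycleMatroid {V E : Type*} (G : Graph V E) (M : Matroid E) : Prop :=
  M.E = G.edgeSet ∧
    ∀ C : Set E, M.IsCircuit C ↔ G.IsFiniteCycleEdgeSet C ∨ G.IsDoubleRayEdgeSet C

/-! ### The matroid `M⁺` -/

/-- `N` is `M⁺`: the ground set of `M` is not a base of `M`, and the bases of `N` are the sets
`B + e` with `B` a base of `M` and `e` an element of the ground set outside `B`.  A matroid is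
determined by its ground set and bases, so there is at most one such `N`. -/
def Matroid.IsPlus {E : Type*} (M N : Matroid E) : Prop :=
  ¬ M.IsBase M.E ∧ N.E = M.E ∧
    ∀ X : Set E, N.IsBase X ↔ ∃ B e, M.IsBase B ∧ e ∈ M.E \ B ∧ X = insert e B

/-! ### The one-sided infinite ladder with an additional loop -/

/-- The vertices: the two sides of the ladder, and the vertex carrying the loop. -/
inductive LadderVertex : Type
  | top (i : ℕ) : LadderVertex
  | bot (i : ℕ) : LadderVertex
  | star : LadderVertex

/-- The edges: `p i` on the top side, `q i` on the bottom side, the rungs `r i`, and the loop `l`. -/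
inductive LadderEdge : Type
  | p (i : ℕ) : LadderEdge
  | q (i : ℕ) : LadderEdge
  | r (i : ℕ) : LadderEdge
  | l : LadderEdge

/-- The pair of ends of an edge. -/
def LadderEdge.ends : LadderEdge → LadderVertex × LadderVertex
  | .p i => (.top i, .top (i + 1))
  | .q i => (.bot i, .bot (i + 1))
  | .r i => (.top i, .bot i)
  | .l => (.star, .star)

/-- The disjoint union of the one-sided infinite ladder and a loop. -/
def loopedLadder : Graph LadderVertex LadderEdge where
  vertexSet := Set.univ
  edgeSet := Set.univ
  IsLink e x y := e.ends = (x, y) ∨ e.ends = (y, x)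
  isLink_symm := fun _ _ => ⟨fun _ _ h => h.symm⟩
  eq_or_eq_of_isLink_of_isLink := by grind
  edge_mem_iff_exists_isLink := fun e => ⟨fun _ => ⟨_, _, Or.inl rfl⟩, fun _ => trivial⟩
  left_mem_of_isLink := fun _ _ _ _ => trivial

/-! A flow on the ladder, infinite support allowed, is determined by its values on the top edges,
because each `{p i, q i}` is a cut with a finite side. Flows (with a free value on the loop) are
exactly the functionals on a space of finitely supported vectors. So `M` can be taken as the dual of
a finitary vector matroid, with no infinite matroid axioms to check: its dependent sets are those
containing the support of a nonzero flow, and the minimal supports are the arcs and the loop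
(`ladderMatroid_not_indep_iff`).

Independence in `M⁺` means containing at most one circuit of `M` (`IsPlus.indep_iff`). To represent
`M⁺`, add to the flow conditions that the total weight vanishes, for weights under which every
circuit carries a flow of nonzero weight (`IsLadderCircuit.exists_flow`). Flows along two distinct
circuits then combine to a nonzero flow of weight zero. Conversely, from a nonzero flow of weight
zero subtract a multiple of a circuit flow inside its support: the remainder is nonzero and yields a
second circuit.

Suppose `f` represents the dual of `M⁺`. The top edges and the loop form a circuit there, so at each
point only finitely many `f (p m)` are nonzero. The star of each top vertex is dependent, so `f (r
(n + 1))` is a combination of `f (p n)` and `f (p (n + 1))` with nonzero coefficient at `f (p n)`,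
and `f (r 0)` is a multiple of `f (p 0)`. Suitable multiples of the rung functions therefore
telescope, and sum to zero pointwise. But the rungs are independent in the dual. -/

/-! ### Matroids of vector families -/

/-- The finitary matroid on the index type of a family `v` of vectors: a set is independent if the
corresponding subfamily is linearly independent. -/
def Matroid.ofVectors (k : Type*) {V E : Type*} [Field k] [AddCommGroup V] [Module k V]
    (v : E → V) : Matroid E :=
  (IndepMatroid.ofFinitaryCardAugment Set.univ (fun I => LinearIndepOn k v I)
    (linearIndepOn_empty k v)
    (fun _ _ hJ hIJ => hJ.mono hIJ)
    (by
      intro I J hI hIfin hJ hJfin hlt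
      by_contra! hno
      have hsub : v '' J ⊆ (Submodule.span k (v '' I) : Set V) := by
        rintro _ ⟨e, he, rfl⟩
        by_cases heI : e ∈ I
        · exact Submodule.subset_span ⟨e, heI, rfl⟩
        · by_contra hspan
          exact hno e he heI (hI.insert hspan)
      have hrank := Submodule.rank_mono (Submodule.span_le.2 hsub)
      have hle := OrderHomClass.mono Cardinal.toENat hrank
      rw [toENat_rank_span_set hI, toENat_rank_span_set hJ, ← hIfin.cast_ncard_eq, ← hJfin.cast_ncard_eq] at hle
      exact absurd (Nat.cast_le.1 hle) (by omega))
    (fun I hI => linearIndepOn_of_finite I hI)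
    (fun _ _ => Set.subset_univ _)).matroid

namespace Matroid

section ofVectors

variable {k V E : Type*} [Field k] [AddCommGroup V] [Module k V] (v : E → V)

@[simp] theorem ofVectors_ground : (ofVectors k v).E = Set.univ := rfl

/-- In the dual of the matroid of a spanning family of vectors, a set is dependent if and only if it
contains the support of a nonzero linear functional. -/
theorem ofVectors_dual_not_indep_iff (hv : Submodule.span k (Set.range v) = ⊤) {I : Set E} :
    ¬ (ofVectors k v)✶.Indep I ↔ ∃ φ : V →ₗ[k] k, φ ≠ 0 ∧ ∀ e, e ∉ I → φ (v e) = 0 := by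
  -- Dual independence means that the complement spans; a proper subspace is annihilated by a
  -- nonzero functional.
  have hspan : (ofVectors k v)✶.Indep I ↔ Submodule.span k (v '' Iᶜ) = ⊤ := by
    rw [dual_indep_iff_exists (by simp)]
    constructor
    · rintro ⟨B, hB, hdisj⟩
      rw [eq_top_iff, ← hv, Submodule.span_le]
      rintro _ ⟨e, rfl⟩
      have hBI : Submodule.span k (v '' B) ≤ Submodule.span k (v '' Iᶜ) :=
        Submodule.span_mono (Set.image_mono hdisj.subset_compl_left)
      apply hBI
      by_cases heB : e ∈ B
      · exact Submodule.subset_span ⟨e, heB, rfl⟩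
      · by_contra hno
        exact heB (hB.mem_of_insert_indep (hB.indep.insert hno))
    · intro htop
      obtain ⟨B, hB⟩ := (ofVectors k v).exists_isBasis Iᶜ
      refine ⟨B, hB.indep.isBase_of_maximal fun J hJ hBJ => ?_,
        Set.disjoint_left.2 fun e heI heB => hB.subset heB heI⟩
      have hBtop : Submodule.span k (v '' B) = ⊤ := by
        rw [eq_top_iff, ← htop, Submodule.span_le]
        rintro _ ⟨e, he, rfl⟩
        by_cases heB : e ∈ B
        · exact Submodule.subset_span ⟨e, heB, rfl⟩
        · by_contra hno
          exact heB (hB.mem_of_insert_indep he (hB.indep.insert hno))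
      refine hBJ.antisymm fun e he => ?_
      by_contra heB
      refine ((show LinearIndepOn k v J from hJ).mono
        (Set.insert_subset he hBJ)).notMem_span_of_insert heB ?_
      rw [hBtop]; trivial
  rw [hspan]
  constructor
  · intro h
    obtain ⟨φ, hφ, hle⟩ := Submodule.exists_le_ker_of_lt_top _ (lt_top_iff_ne_top.2 h)
    exact ⟨φ, hφ, fun e he => hle (Submodule.subset_span ⟨e, he, rfl⟩)⟩
  · rintro ⟨φ, hφ, hz⟩ htop
    apply hφ
    rw [← LinearMap.ker_eq_top, eq_top_iff, ← htop, Submodule.span_le]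
    rintro _ ⟨e, he, rfl⟩
    exact hz e he

end ofVectors

/-! ### Existence of `M⁺` -/

variable {E : Type*} {M N : Matroid E}

/-- The bases of `M⁺`. -/
def IsPlusBase (M : Matroid E) (X : Set E) : Prop := ∃ B e, M.IsBase B ∧ e ∈ M.E \ B ∧ X = insert e B

theorem IsBase.isPlusBase_insert {B : Set E} {b : E} (hB : M.IsBase B) (hb : b ∈ M.E)
    (hbB : b ∉ B) : M.IsPlusBase (insert b B) := ⟨B, b, hB, ⟨hb, hbB⟩, rfl⟩

theorem isPlusBase_exchange (M : Matroid E) : ExchangeProperty M.IsPlusBase := by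
  -- If `X \ {a}` is already a base of `M`, any element of `Y` outside it will do, and one exists
  -- because `Y` properly contains a base.
  have hbase : ∀ X Y a, M.IsBase (X \ {a}) → M.IsPlusBase Y → a ∉ Y →
      ∃ b ∈ Y \ X, M.IsPlusBase (insert b (X \ {a})) := by
    rintro X _ a hX ⟨B, e, hB, he, rfl⟩ ha
    have hns : ¬ insert e B ⊆ X \ {a} := by
      intro hsub
      have := hB.eq_of_subset_isBase hX ((Set.subset_insert e B).trans hsub)
      exact he.2 (this ▸ hsub (Set.mem_insert e B))
    obtain ⟨b, hb, hbX⟩ := Set.not_subset.1 hns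
    have hba : b ≠ a := fun h => ha (h ▸ hb)
    refine ⟨b, ⟨hb, fun h => hbX ⟨h, hba⟩⟩, hX.isPlusBase_insert ?_ hbX⟩
    exact Set.insert_subset he.1 hB.subset_ground hb
  rintro X Y ⟨B, e, hB, he, rfl⟩ hY a ⟨haX, haY⟩
  by_cases hae : a = e
  · subst hae
    refine hbase _ _ _ ?_ hY haY
    rwa [Set.insert_sdiff_self_of_notMem he.2]
  have haB : a ∈ B := haX.resolve_left hae
  obtain ⟨B', e', hB', he', rfl⟩ := id hY
  obtain ⟨b, hb, hbase'⟩ := hB.exchange hB' (e := a)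
    ⟨haB, fun h => haY (Set.mem_insert_of_mem _ h)⟩
  have hcomm : insert e B \ {a} = insert e (B \ {a}) := by
    rw [Set.insert_sdiff_of_notMem _ (by simpa using Ne.symm hae)]
  -- If the exchange in `M` brings in `e` itself, then `X \ {a}` is a base; otherwise `e` remains
  -- the extra element.
  by_cases hbe : b = e
  · subst hbe
    exact hbase _ _ _ (hcomm ▸ hbase') hY haY
  · refine ⟨b, ⟨Set.mem_insert_of_mem _ hb.1, ?_⟩, ?_⟩
    · rintro (h | h)
      exacts [hbe h, hb.2 h]
    · rw [hcomm, Set.insert_comm]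
      refine hbase'.isPlusBase_insert he.1 ?_
      rintro (h | h)
      exacts [hbe h.symm, he.2 h.1]

/-- A basis `J` of `X` plus one further element of `X` is maximal, and `X` itself is maximal when `J
= X`. It remains to choose `J` and the extra element so as to cover `I`. -/
theorem isPlusBase_maximality (hM : ¬ M.IsBase M.E) (X : Set E) (hX : X ⊆ M.E) :
    ExistsMaximalSubsetProperty (∃ B, M.IsPlusBase B ∧ · ⊆ B) X := by
  rintro I ⟨_, ⟨B, e, hB, he, rfl⟩, hIB⟩ hIX
  have hext : ∀ J f, M.IsBasis J X → f ∈ X → f ∉ J →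
      Maximal (fun K ↦ (∃ B, M.IsPlusBase B ∧ K ⊆ B) ∧ K ⊆ X) (insert f J) := by
    intro J f hJ hf hfJ
    refine ⟨⟨?_, Set.insert_subset hf hJ.subset⟩, ?_⟩
    · obtain ⟨B', hB', hJB'⟩ := hJ.exists_isBase
      refine ⟨insert f B', hB'.isPlusBase_insert (hX hf) fun h => hfJ ?_,
        Set.insert_subset_insert (hJB' ▸ Set.inter_subset_left)⟩
      exact hJB' ▸ ⟨h, hf⟩
    · rintro K ⟨⟨_, ⟨B', e', hB', he', rfl⟩, hKB'⟩, hKX⟩ hJK g hg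
      by_contra hgJ
      have hKind : M.Indep (K \ {e'}) := hB'.indep.subset (by
        rintro x ⟨hx, hxe⟩
        exact (hKB' hx).resolve_left hxe)
      obtain ⟨J', hJ', hKJ'⟩ := hKind.subset_isBasis_of_subset (Set.sdiff_subset.trans hKX)
      -- `J \ J'` has at most the element `e'`, so `J' \ J` has at most one element; this leaves no
      -- room in `K` for both `f` and `g` outside `J`.
      have hcard := hJ.isBase_restrict.encard_sdiff_comm hJ'.isBase_restrict
      have hmem : ∀ x ∈ K, x ≠ e' → x ∈ J' := fun x hx hxe => hKJ' ⟨hx, hxe⟩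
      have hJK' : ∀ x ∈ J, x ∈ K := fun x hx => hJK (Set.mem_insert_of_mem _ hx)
      have hfK : f ∈ K := hJK (Set.mem_insert _ _)
      have hgf : g ≠ f := fun h => hgJ (h ▸ Set.mem_insert _ _)
      have hgJ' : g ∉ J := fun h => hgJ (Set.mem_insert_of_mem _ h)
      have hsub : J \ J' ⊆ {e'} := by
        rintro x ⟨hx, hx'⟩
        by_contra hne
        exact hx' (hmem x (hJK' x hx) hne)
      by_cases heJ : e' ∈ J \ J'
      · have h1 : ({f, g} : Set E) ⊆ J' \ J := by
          rintro x (rfl | rfl)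
          · exact ⟨hmem _ hfK fun h => hfJ (h ▸ heJ.1), hfJ⟩
          · exact ⟨hmem _ hg fun h => hgJ' (h ▸ heJ.1), hgJ'⟩
        have h2 := Set.encard_le_encard h1
        rw [Set.encard_pair hgf.symm, ← hcard] at h2
        have h3 := h2.trans (Set.encard_le_encard hsub)
        rw [Set.encard_singleton] at h3
        exact absurd h3 (by decide)
      · have h0 : J \ J' = ∅ := by
          refine Set.eq_empty_of_forall_notMem fun x hx => heJ ?_
          exact (hsub hx : x = e') ▸ hx
        rw [h0, Set.encard_empty, eq_comm, Set.encard_eq_zero, Set.sdiff_eq_empty] at hcard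
        have hf' : f = e' := by
          by_contra h
          exact hfJ (hcard (hmem f hfK h))
        have hg' : g = e' := by
          by_contra h
          exact hgJ' (hcard (hmem g hg h))
        exact hgf (hg'.trans hf'.symm)
  have hIind : M.Indep (I \ {e}) := hB.indep.subset (by
    rintro x ⟨hx, hxe⟩
    exact (hIB hx).resolve_left hxe)
  obtain ⟨J, hJ, hIJ⟩ := hIind.subset_isBasis_of_subset (Set.sdiff_subset.trans hIX)
  by_cases hex : e ∈ I ∧ e ∉ J
  · exact ⟨insert e J, by simpa using hIJ, hext J e hJ (hIX hex.1) hex.2⟩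
  have hIJ' : I ⊆ J := by
    intro x hx
    by_cases hxe : x = e
    · subst hxe
      by_contra h
      exact hex ⟨hx, h⟩
    · exact hIJ ⟨hx, hxe⟩
  by_cases hJX : X ⊆ J
  · obtain rfl : J = X := hJ.subset.antisymm hJX
    obtain ⟨B', hB', hJB'⟩ := hJ.indep.exists_isBase_superset
    have hne : ¬ M.E ⊆ B' := fun h => hM (hB'.subset_ground.antisymm h ▸ hB')
    obtain ⟨f, hf, hfB⟩ := Set.not_subset.1 hne
    exact ⟨J, hIX, ⟨⟨_, hB'.isPlusBase_insert hf hfB, hJB'.trans (Set.subset_insert _ _)⟩,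
      subset_rfl⟩, fun K hK _ => hK.2⟩
  · obtain ⟨f, hf, hfJ⟩ := Set.not_subset.1 hJX
    exact ⟨insert f J, hIJ'.trans (Set.subset_insert _ _), hext J f hJ hf hfJ⟩

theorem exists_isPlus (hM : ¬ M.IsBase M.E) : ∃ N, M.IsPlus N := by
  obtain ⟨B, hB⟩ := M.exists_isBase
  have hne : ¬ M.E ⊆ B := fun h => hM (hB.subset_ground.antisymm h ▸ hB)
  obtain ⟨f, hf, hfB⟩ := Set.not_subset.1 hne
  exact ⟨Matroid.ofBase M.E M.IsPlusBase ⟨_, hB.isPlusBase_insert hf hfB⟩ M.isPlusBase_exchange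
    (isPlusBase_maximality hM) (by
      rintro _ ⟨B, e, hB, he, rfl⟩
      exact Set.insert_subset he.1 hB.subset_ground), hM, rfl, fun X => Iff.rfl⟩

/-- A set is independent in `M⁺` if and only if it contains at most one circuit of `M`. -/
theorem IsPlus.indep_iff (h : M.IsPlus N) {I : Set E} (hI : I ⊆ M.E) :
    N.Indep I ↔ ∀ C C', M.IsCircuit C → M.IsCircuit C' → C ⊆ I → C' ⊆ I → C = C' := by
  rw [N.indep_iff]
  constructor
  · rintro ⟨X, hX, hIX⟩ C C' hC hC' hCI hCI'
    obtain ⟨B, e, hB, he, rfl⟩ := (h.2.2 X).1 hX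
    by_contra hne
    -- Eliminating the extra element `e` from two circuits leaves a circuit inside the base `B`.
    obtain ⟨D, hD, hDc⟩ := hC.elimination hC' hne e
    refine hDc.not_indep (hB.indep.subset fun x hx => ?_)
    have := hD hx
    exact (hIX (Set.union_subset hCI hCI' this.1)).resolve_left this.2
  · intro huniq
    have key : ∃ B e, M.IsBase B ∧ e ∈ M.E \ B ∧ I ⊆ insert e B := by
      by_cases hind : M.Indep I
      · obtain ⟨B, hB, hIB⟩ := hind.exists_isBase_superset
        have hne : ¬ M.E ⊆ B := fun h' => h.1 (hB.subset_ground.antisymm h' ▸ hB)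
        obtain ⟨f, hf, hfB⟩ := Set.not_subset.1 hne
        exact ⟨B, f, hB, ⟨hf, hfB⟩, hIB.trans (Set.subset_insert _ _)⟩
      · obtain ⟨C, hCI, hC⟩ := (dep_of_not_indep hind hI).exists_isCircuit_subset
        obtain ⟨e, he⟩ := hC.nonempty
        have hind' : M.Indep (I \ {e}) := by
          by_contra hdep
          obtain ⟨C', hCI', hC'⟩ :=
            (dep_of_not_indep hdep (Set.sdiff_subset.trans hI)).exists_isCircuit_subset
          have := huniq C C' hC hC' hCI (hCI'.trans Set.sdiff_subset)
          exact (hCI' (this ▸ he)).2 rfl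
        obtain ⟨B, hB, hIB⟩ := hind'.exists_isBase_superset
        refine ⟨B, e, hB, ⟨hI (hCI he), fun heB => hind (hB.indep.subset fun x hx => ?_)⟩,
          by simpa using hIB⟩
        by_cases hxe : x = e
        · exact hxe ▸ heB
        · exact hIB ⟨hx, hxe⟩
    obtain ⟨B, e, hB, he, hIB⟩ := key
    exact ⟨_, (h.2.2 _).2 ⟨B, e, hB, he, rfl⟩, hIB⟩

/-- A set is independent in the dual of `M⁺` if and only if it avoids a set `B + e` with `B` a base
of `M`. -/
theorem IsPlus.dual_indep_iff (h : M.IsPlus N) {I : Set E} (hI : I ⊆ M.E) :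
    N✶.Indep I ↔ ∃ B e, M.IsBase B ∧ e ∈ M.E \ B ∧ Disjoint I (insert e B) := by
  rw [dual_indep_iff_exists (by rwa [h.2.1])]
  constructor
  · rintro ⟨X, hX, hdisj⟩
    obtain ⟨B, e, hB, he, rfl⟩ := (h.2.2 X).1 hX
    exact ⟨B, e, hB, he, hdisj⟩
  · rintro ⟨B, e, hB, he, hdisj⟩
    exact ⟨_, (h.2.2 _).2 ⟨B, e, hB, he, rfl⟩, hdisj⟩

end Matroid

/-! ### Circuits of the ladder -/

/-- The edges of the ladder forming the boundary of the union of the squares in columns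
`i, i + 1, …, j - 1`: a finite cycle if `j` is finite, and a double ray if `j = ⊤`. -/
def ladderArc (i : ℕ) (j : ℕ∞) : Set LadderEdge :=
  {e | match e with
    | .p m => i ≤ m ∧ (m : ℕ∞) < j
    | .q m => i ≤ m ∧ (m : ℕ∞) < j
    | .r m => m = i ∨ (m : ℕ∞) = j
    | .l => False}

section mem

variable {i m : ℕ} {j : ℕ∞}

@[simp] theorem p_mem_ladderArc : .p m ∈ ladderArc i j ↔ i ≤ m ∧ (m : ℕ∞) < j := Iff.rfl
@[simp] theorem q_mem_ladderArc : .q m ∈ ladderArc i j ↔ i ≤ m ∧ (m : ℕ∞) < j := Iff.rfl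
@[simp] theorem r_mem_ladderArc : .r m ∈ ladderArc i j ↔ m = i ∨ (m : ℕ∞) = j := Iff.rfl
@[simp] theorem l_notMem_ladderArc : .l ∉ ladderArc i j := id

end mem

/-- The circuits of the algebraic cycle matroid of the ladder with a loop. -/
def IsLadderCircuit (C : Set LadderEdge) : Prop :=
  C = {.l} ∨ ∃ (i : ℕ) (j : ℕ∞), (i : ℕ∞) < j ∧ C = ladderArc i j

/-- The vertex `x` is an end of the edge `e`. -/
def LadderEdge.Inc (e : LadderEdge) (x : LadderVertex) : Prop := x = e.ends.1 ∨ x = e.ends.2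

/-- No vertex of the ladder is incident to exactly one edge of `S`. -/
def NoLeaf (S : Set LadderEdge) : Prop :=
  ∀ e ∈ S, e ≠ .l → ∀ x, e.Inc x → ∃ e' ∈ S, e' ≠ e ∧ e'.Inc x

section Inc

open LadderEdge LadderVertex

variable {i j : ℕ}

@[simp] theorem p_inc_top : (p i).Inc (top j) ↔ j = i ∨ j = i + 1 := by simp [Inc, ends]
@[simp] theorem p_inc_bot : ¬ (p i).Inc (bot j) := by simp [Inc, ends]
@[simp] theorem p_inc_star : ¬ (p i).Inc star := by simp [Inc, ends]
@[simp] theorem q_inc_bot : (q i).Inc (bot j) ↔ j = i ∨ j = i + 1 := by simp [Inc, ends]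
@[simp] theorem q_inc_top : ¬ (q i).Inc (top j) := by simp [Inc, ends]
@[simp] theorem q_inc_star : ¬ (q i).Inc star := by simp [Inc, ends]
@[simp] theorem r_inc_top : (r i).Inc (top j) ↔ j = i := by simp [Inc, ends]
@[simp] theorem r_inc_bot : (r i).Inc (bot j) ↔ j = i := by simp [Inc, ends]
@[simp] theorem r_inc_star : ¬ (r i).Inc star := by simp [Inc, ends]
@[simp] theorem l_inc_top : ¬ l.Inc (top j) := by simp [Inc, ends]
@[simp] theorem l_inc_bot : ¬ l.Inc (bot j) := by simp [Inc, ends]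

theorem inc_top_iff {e : LadderEdge} :
    e.Inc (top i) ↔ e = p i ∨ e = r i ∨ ∃ m, i = m + 1 ∧ e = p m := by
  cases e <;> simp <;> grind

theorem inc_bot_iff {e : LadderEdge} :
    e.Inc (bot i) ↔ e = q i ∨ e = r i ∨ ∃ m, i = m + 1 ∧ e = q m := by
  cases e <;> simp <;> grind

end Inc

section NoLeaf

open LadderEdge LadderVertex

variable {S : Set LadderEdge} {i : ℕ} (hS : NoLeaf S)

include hS

theorem NoLeaf.p_zero (h : p 0 ∈ S) : r 0 ∈ S := by
  obtain ⟨e, he, hne, hinc⟩ := hS _ h (by simp) (top 0) (by simp)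
  rw [inc_top_iff] at hinc; grind

theorem NoLeaf.q_zero (h : q 0 ∈ S) : r 0 ∈ S := by
  obtain ⟨e, he, hne, hinc⟩ := hS _ h (by simp) (bot 0) (by simp)
  rw [inc_bot_iff] at hinc; grind

theorem NoLeaf.r_zero (h : r 0 ∈ S) : p 0 ∈ S ∧ q 0 ∈ S := by
  obtain ⟨e, he, hne, hinc⟩ := hS _ h (by simp) (top 0) (by simp)
  obtain ⟨e', he', hne', hinc'⟩ := hS _ h (by simp) (bot 0) (by simp)
  rw [inc_top_iff] at hinc; rw [inc_bot_iff] at hinc'; grind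

theorem NoLeaf.p_right (h : p i ∈ S) : p (i + 1) ∈ S ∨ r (i + 1) ∈ S := by
  obtain ⟨e, he, hne, hinc⟩ := hS _ h (by simp) (top (i + 1)) (by simp)
  rw [inc_top_iff] at hinc; grind

theorem NoLeaf.q_right (h : q i ∈ S) : q (i + 1) ∈ S ∨ r (i + 1) ∈ S := by
  obtain ⟨e, he, hne, hinc⟩ := hS _ h (by simp) (bot (i + 1)) (by simp)
  rw [inc_bot_iff] at hinc; grind

theorem NoLeaf.p_left (h : p (i + 1) ∈ S) : p i ∈ S ∨ r (i + 1) ∈ S := by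
  obtain ⟨e, he, hne, hinc⟩ := hS _ h (by simp) (top (i + 1)) (by simp)
  rw [inc_top_iff] at hinc; grind

theorem NoLeaf.q_left (h : q (i + 1) ∈ S) : q i ∈ S ∨ r (i + 1) ∈ S := by
  obtain ⟨e, he, hne, hinc⟩ := hS _ h (by simp) (bot (i + 1)) (by simp)
  rw [inc_bot_iff] at hinc; grind

theorem NoLeaf.r_succ (h : r (i + 1) ∈ S) :
    (p i ∈ S ∨ p (i + 1) ∈ S) ∧ (q i ∈ S ∨ q (i + 1) ∈ S) := by
  obtain ⟨e, he, hne, hinc⟩ := hS _ h (by simp) (top (i + 1)) (by simp)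
  obtain ⟨e', he', hne', hinc'⟩ := hS _ h (by simp) (bot (i + 1)) (by simp)
  rw [inc_top_iff] at hinc; rw [inc_bot_iff] at hinc'; grind

/-- A set of edges without leaves contains a finite cycle or a double ray. -/
theorem NoLeaf.exists_ladderArc_subset {e : LadderEdge} (he : e ∈ S) (hel : e ≠ l) :
    ∃ (i : ℕ) (j : ℕ∞), (i : ℕ∞) < j ∧ ladderArc i j ⊆ S := by
  classical
  have hex : ∃ i, p i ∈ S ∨ q i ∈ S ∨ r i ∈ S := by
    cases e with
    | p i => exact ⟨i, .inl he⟩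
    | q i => exact ⟨i, .inr (.inl he)⟩
    | r i => exact ⟨i, .inr (.inr he)⟩
    | l => exact absurd rfl hel
  -- In the leftmost column that meets `S`, nothing continues to the left, so all three edges must
  -- be present.
  have hi : ∃ i, p i ∈ S ∧ q i ∈ S ∧ r i ∈ S := by
    refine ⟨Nat.find hex, ?_⟩
    have hspec := Nat.find_spec hex
    have hmin := fun m => Nat.find_min hex (m := m)
    generalize Nat.find hex = i at hspec hmin
    cases i with
    | zero =>
      have := hS.p_zero
      have := hS.q_zero
      have := hS.r_zero
      grind
    | succ k =>
      have hk := hmin k (by omega)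
      have := hS.p_left (i := k)
      have := hS.q_left (i := k)
      have := hS.r_succ (i := k)
      grind
  obtain ⟨i, hp, hq, hr⟩ := hi
  -- Both sides are forced to continue until the next rung in `S`; if there is none, the result is a
  -- double ray.
  have hrun : ∀ n, (∀ m, i < m → m ≤ i + n → r m ∉ S) → p (i + n) ∈ S ∧ q (i + n) ∈ S := by
    intro n
    induction n with
    | zero => exact fun _ => ⟨hp, hq⟩
    | succ n ih =>
      intro hno
      obtain ⟨h1, h2⟩ := ih fun m hm hm' => hno m hm (by omega)
      have h3 := hno (i + n + 1) (by omega) (by omega)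
      exact ⟨(hS.p_right h1).resolve_right h3, (hS.q_right h2).resolve_right h3⟩
  by_cases hj : ∃ j, i < j ∧ r j ∈ S
  · refine ⟨i, (Nat.find hj : ℕ), ?_, ?_⟩
    · exact_mod_cast (Nat.find_spec hj).1
    · have hrun' : ∀ m, i ≤ m → m < Nat.find hj → p m ∈ S ∧ q m ∈ S := by
        intro m him hmj
        obtain ⟨n, rfl⟩ := Nat.exists_eq_add_of_le him
        exact hrun n fun a ha ha' har => Nat.find_min hj (ha'.trans_lt hmj) ⟨ha, har⟩
      rintro (m | m | m | _) hm
      · exact (hrun' m hm.1 (by exact_mod_cast hm.2)).1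
      · exact (hrun' m hm.1 (by exact_mod_cast hm.2)).2
      · rcases hm with rfl | hm
        · exact hr
        · rw [Nat.cast_inj.1 hm]
          exact (Nat.find_spec hj).2
      · exact hm.elim
  · push Not at hj
    refine ⟨i, ⊤, ENat.natCast_lt_top i, ?_⟩
    have hrun' : ∀ m, i ≤ m → p m ∈ S ∧ q m ∈ S := by
      intro m him
      obtain ⟨n, rfl⟩ := Nat.exists_eq_add_of_le him
      exact hrun n fun a ha _ => hj a ha
    rintro (m | m | m | _) hm
    · exact (hrun' m hm.1).1
    · exact (hrun' m hm.1).2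
    · rcases hm with rfl | hm
      · exact hr
      · exact absurd hm (ENat.natCast_ne_top m)
    · exact hm.elim

end NoLeaf

section arc

open LadderEdge LadderVertex

variable {i i' : ℕ} {j j' : ℕ∞}

theorem noLeaf_ladderArc (hij : (i : ℕ∞) < j) : NoLeaf (ladderArc i j) := by
  have hp : ∀ m : ℕ, p m ∈ ladderArc i j →
      p (m + 1) ∈ ladderArc i j ∨ r (m + 1) ∈ ladderArc i j := by
    intro m hm
    cases j with
    | top => left; simp at hm ⊢; omega
    | coe j => simp at hm ⊢; norm_cast; omega
  have hp' : ∀ m : ℕ, p m ∈ ladderArc i j →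
      r m ∈ ladderArc i j ∨ ∃ n, m = n + 1 ∧ p n ∈ ladderArc i j := by
    intro m hm
    by_cases hmi : m = i
    · exact .inl (.inl hmi)
    · obtain ⟨n, rfl⟩ : ∃ n, m = n + 1 := ⟨m - 1, by have := hm.1; omega⟩
      refine .inr ⟨n, rfl, ?_, lt_of_le_of_lt ?_ hm.2⟩
      · have := hm.1; omega
      · exact_mod_cast Nat.le_succ n
  have hr : ∀ m : ℕ, r m ∈ ladderArc i j →
      p m ∈ ladderArc i j ∨ ∃ n, m = n + 1 ∧ p n ∈ ladderArc i j := by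
    rintro m (rfl | rfl)
    · exact .inl ⟨le_rfl, hij⟩
    · have hij' : i < m := by exact_mod_cast hij
      obtain ⟨n, rfl⟩ : ∃ n, m = n + 1 := ⟨m - 1, by omega⟩
      refine .inr ⟨n, rfl, by omega, by norm_cast; omega⟩
  have hpq : ∀ m, p m ∈ ladderArc i j ↔ q m ∈ ladderArc i j := fun m => Iff.rfl
  rintro (m | m | m | _) he hel (x | x | _) hx
  all_goals try exact absurd rfl hel
  all_goals simp only [p_inc_top, p_inc_bot, p_inc_star, q_inc_bot, q_inc_top, q_inc_star,
    r_inc_top, r_inc_bot, r_inc_star] at hx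
  · simp only [inc_top_iff]; grind
  · simp only [inc_bot_iff]; grind
  · simp only [inc_top_iff]; grind
  · simp only [inc_bot_iff]; grind

/-- The rung and top edge in column `i'` fix the left end; the right end is fixed by the rung `r
j'`, or by `p j` when `j' = ⊤`. -/
theorem ladderArc_eq_of_subset (hij : (i : ℕ∞) < j) (hij' : (i' : ℕ∞) < j')
    (h : ladderArc i' j' ⊆ ladderArc i j) : ladderArc i' j' = ladderArc i j := by
  have h1 : p i' ∈ ladderArc i j := h ⟨le_rfl, hij'⟩
  have h2 : r i' ∈ ladderArc i j := h (.inl rfl)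
  obtain rfl : i' = i := h2.resolve_right h1.2.ne
  cases j' with
  | top =>
    cases j with
    | top => rfl
    | coe j =>
      have h3 : p j ∈ ladderArc i' j := h ⟨by exact_mod_cast hij.le, ENat.natCast_lt_top j⟩
      exact absurd h3.2 (lt_irrefl _)
  | coe j' =>
    have h3 : r j' ∈ ladderArc i' j := h (.inr rfl)
    rcases h3 with h3 | h3
    · subst h3
      exact absurd hij' (lt_irrefl _)
    · rw [h3]

theorem IsLadderCircuit.eq_of_subset {C C' : Set LadderEdge} (hC : IsLadderCircuit C)
    (hC' : IsLadderCircuit C') (h : C' ⊆ C) : C' = C := by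
  rcases hC with rfl | ⟨i, j, hij, rfl⟩ <;> rcases hC' with rfl | ⟨i', j', hij', rfl⟩
  · rfl
  · have := h (show r i' ∈ _ from .inl rfl)
    simp at this
  · exact absurd (h rfl) l_notMem_ladderArc
  · exact ladderArc_eq_of_subset hij hij' h

end arc

/-! ### Flows on the ladder -/

section flow

open LadderEdge LadderVertex

variable {k : Type*} [Field k]

/-- The flow on the ladder with a loop with value `y i` on `p i` and value `t` on the loop. -/
def ladderFlow (y : ℕ → k) (t : k) : LadderEdge → k
  | p i => y i
  | q i => -y i
  | r 0 => -y 0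
  | r (i + 1) => y i - y (i + 1)
  | l => t

/-- At each ladder vertex the signed values sum to zero, so they cannot have exactly one nonzero
term. -/
theorem noLeaf_support_ladderFlow (y : ℕ → k) (t : k) : NoLeaf {e | ladderFlow y t e ≠ 0} := by
  have hr : ∀ m, r m ∈ {e | ladderFlow y t e ≠ 0} ↔
      y m ≠ 0 ∧ m = 0 ∨ ∃ n, m = n + 1 ∧ y n ≠ y m := by
    rintro (_ | m) <;> simp [ladderFlow, sub_eq_zero]
  have hp : ∀ m, p m ∈ {e | ladderFlow y t e ≠ 0} ↔ y m ≠ 0 := fun m => Iff.rfl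
  have hq : ∀ m, q m ∈ {e | ladderFlow y t e ≠ 0} ↔ y m ≠ 0 := fun m => neg_ne_zero
  generalize {e | ladderFlow y t e ≠ 0} = S at hr hp hq
  rintro (m | m | m | _) he hel (x | x | _) hx
  all_goals try exact absurd rfl hel
  all_goals simp only [p_inc_top, p_inc_bot, p_inc_star, q_inc_bot, q_inc_top, q_inc_star,
    r_inc_top, r_inc_bot, r_inc_star] at hx
  · simp only [inc_top_iff]; cases x <;> grind
  · simp only [inc_bot_iff]; cases x <;> grind
  · simp only [inc_top_iff]; cases x <;> grind
  · simp only [inc_bot_iff]; cases x <;> grind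

/-- The support of a nonzero flow contains a circuit. -/
theorem exists_isLadderCircuit_of_ladderFlow {y : ℕ → k} {t : k} {e : LadderEdge}
    (he : ladderFlow y t e ≠ 0) :
    ∃ C, IsLadderCircuit C ∧ ∀ f ∈ C, ladderFlow y t f ≠ 0 := by
  by_cases hel : e = l
  · subst hel
    exact ⟨{l}, .inl rfl, by rintro f rfl; exact he⟩
  · obtain ⟨i, j, hij, hsub⟩ := (noLeaf_support_ladderFlow y t).exists_ladderArc_subset he hel
    exact ⟨_, .inr ⟨i, j, hij, rfl⟩, hsub⟩

open Classical in
/-- The values on the edges `p m` of the flow along the circuit `ladderArc i j`. -/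
noncomputable def arcFlow (k : Type*) [Field k] (i : ℕ) (j : ℕ∞) (m : ℕ) : k :=
  if i ≤ m ∧ (m : ℕ∞) < j then 1 else 0

/-- Rungs carry the differences of consecutive values of an indicator, so only its jumps at `i` and
`j` contribute. -/
theorem ladderFlow_arcFlow_r {i : ℕ} {j : ℕ∞} (hij : (i : ℕ∞) < j) (m : ℕ) :
    ladderFlow (arcFlow k i j) 0 (r m) =
      if m = i then -1 else if (m : ℕ∞) = j then 1 else 0 := by
  cases m with
  | zero =>
    simp only [ladderFlow, arcFlow]
    cases j with
    | top => simp; grind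
    | coe j => simp only [Nat.cast_inj, Nat.cast_lt] at hij ⊢; grind
  | succ m =>
    simp only [ladderFlow, arcFlow]
    cases j with
    | top => simp only [ENat.natCast_lt_top, and_true, ENat.natCast_ne_top]; grind
    | coe j => simp only [Nat.cast_inj, Nat.cast_lt] at hij ⊢; grind

theorem ladderFlow_arcFlow_eq_zero {i : ℕ} {j : ℕ∞} (hij : (i : ℕ∞) < j) {e : LadderEdge}
    (he : e ∉ ladderArc i j) : ladderFlow (arcFlow k i j) 0 e = 0 := by
  cases e with
  | p m => exact if_neg he
  | q m => exact neg_eq_zero.2 (if_neg he)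
  | r m =>
    rw [r_mem_ladderArc, not_or] at he
    rw [ladderFlow_arcFlow_r hij, if_neg he.1, if_neg he.2]
  | l => rfl

theorem ladderFlow_sub_smul (y y' : ℕ → k) (t t' c : k) (e : LadderEdge) :
    ladderFlow (y - c • y') (t - c * t') e = ladderFlow y t e - c * ladderFlow y' t' e := by
  rcases e with m | m | (_ | m) | _ <;> simp [ladderFlow] <;> ring

end flow

/-! ### The algebraic cycle matroid of the ladder with a loop -/

section matroid

open LadderEdge Matroid

/-- Vectors whose linear functionals are the flows on the ladder with a loop. -/
noncomputable def ladderVector : LadderEdge → (Option ℕ →₀ ℚ)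
  | p i => .single (some i) 1
  | q i => -.single (some i) 1
  | r 0 => -.single (some 0) 1
  | r (i + 1) => .single (some i) 1 - .single (some (i + 1)) 1
  | l => .single none 1

theorem apply_ladderVector (φ : (Option ℕ →₀ ℚ) →ₗ[ℚ] ℚ) (e : LadderEdge) :
    φ (ladderVector e) =
      ladderFlow (fun i => φ (.single (some i) 1)) (φ (.single none 1)) e := by
  rcases e with m | m | (_ | m) | _ <;> simp [ladderVector, ladderFlow]

theorem span_range_ladderVector : Submodule.span ℚ (Set.range ladderVector) = ⊤ := by
  rw [eq_top_iff, ← Finsupp.basisSingleOne.span_eq, Submodule.span_le]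
  rintro _ ⟨_ | i, rfl⟩
  · exact Submodule.subset_span ⟨l, by simp [ladderVector]⟩
  · exact Submodule.subset_span ⟨p i, by simp [ladderVector]⟩

/-- The algebraic cycle matroid of the ladder with a loop. -/
noncomputable def ladderMatroid : Matroid LadderEdge := (ofVectors ℚ ladderVector)✶

@[simp] theorem ladderMatroid_ground : ladderMatroid.E = Set.univ := rfl

theorem ladderMatroid_not_indep_iff {I : Set LadderEdge} :
    ¬ ladderMatroid.Indep I ↔ ∃ C, IsLadderCircuit C ∧ C ⊆ I := by
  rw [ladderMatroid, ofVectors_dual_not_indep_iff _ span_range_ladderVector]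
  constructor
  · rintro ⟨φ, hφ, hI⟩
    simp only [apply_ladderVector] at hI
    have hex : ∃ e, ladderFlow (fun i => φ (.single (some i) 1)) (φ (.single none 1)) e ≠ 0 := by
      by_contra! h
      refine hφ (Finsupp.basisSingleOne.ext ?_)
      rintro (_ | i)
      · simpa [ladderFlow] using h l
      · simpa [ladderFlow] using h (p i)
    obtain ⟨e, he⟩ := hex
    obtain ⟨C, hC, hsub⟩ := exists_isLadderCircuit_of_ladderFlow he
    exact ⟨C, hC, fun f hf => by_contra fun hfI => hsub f hf (hI f hfI)⟩
  · rintro ⟨C, hC, hCI⟩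
    -- A functional takes arbitrary values on a basis, even infinitely many nonzero ones; this is
    -- how double rays become dependent.
    have key : ∀ (y : ℕ → ℚ) (t : ℚ), (∃ e, ladderFlow y t e ≠ 0) →
        (∀ e, e ∉ I → ladderFlow y t e = 0) →
        ∃ φ : (Option ℕ →₀ ℚ) →ₗ[ℚ] ℚ, φ ≠ 0 ∧ ∀ e, e ∉ I → φ (ladderVector e) = 0 := by
      rintro y t ⟨e, he⟩ hI
      have hφ : ∀ f, Finsupp.linearCombination ℚ (fun o : Option ℕ => o.elim t y)
          (ladderVector f) = ladderFlow y t f := by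
        intro f
        simp [apply_ladderVector]
      refine ⟨Finsupp.linearCombination ℚ (fun o : Option ℕ => o.elim t y), fun h => he ?_,
        fun f hf => (hφ f).trans (hI f hf)⟩
      rw [← hφ, h, LinearMap.zero_apply]
    rcases hC with rfl | ⟨i, j, hij, rfl⟩
    · refine key 0 1 ⟨l, one_ne_zero⟩ fun e he => ?_
      rcases e with m | m | (_ | m) | _
      all_goals first | exact absurd (hCI rfl) he | simp [ladderFlow]
    · refine key (arcFlow ℚ i j) 0 ⟨r i, ?_⟩ fun e he =>
        ladderFlow_arcFlow_eq_zero hij fun h => he (hCI h)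
      rw [ladderFlow_arcFlow_r hij, if_pos rfl]
      norm_num

theorem IsLadderCircuit.dep {C : Set LadderEdge} (hC : IsLadderCircuit C) :
    ladderMatroid.Dep C :=
  dep_of_not_indep (ladderMatroid_not_indep_iff.2 ⟨C, hC, subset_rfl⟩)

theorem ladderMatroid_isCircuit_iff {C : Set LadderEdge} :
    ladderMatroid.IsCircuit C ↔ IsLadderCircuit C := by
  constructor
  · intro h
    obtain ⟨D, hD, hDC⟩ := ladderMatroid_not_indep_iff.1 h.not_indep
    exact h.eq_of_dep_subset hD.dep hDC ▸ hD
  · intro h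
    refine isCircuit_iff.2 ⟨h.dep, fun D hD hDC => hDC.antisymm ?_⟩
    obtain ⟨C', hC', hC'D⟩ := ladderMatroid_not_indep_iff.1 hD.not_indep
    exact h.eq_of_subset hC' (hC'D.trans hDC) ▸ hC'D

theorem ladderMatroid_isBase {B : Set LadderEdge} (h : ∀ C, IsLadderCircuit C → ¬ C ⊆ B)
    (h' : ∀ e, e ∉ B → ∃ C, IsLadderCircuit C ∧ C ⊆ insert e B) : ladderMatroid.IsBase B := by
  have hind : ladderMatroid.Indep B := by
    by_contra hdep
    obtain ⟨C, hC, hCB⟩ := ladderMatroid_not_indep_iff.1 hdep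
    exact h C hC hCB
  exact hind.isBase_of_forall_insert fun e he =>
    ladderMatroid_not_indep_iff.2 (h' e he.2)

theorem isLadderCircuit_singleton_l : IsLadderCircuit {l} := .inl rfl

theorem isLadderCircuit_square (i : ℕ) : IsLadderCircuit (ladderArc i (i + 1 : ℕ)) :=
  .inr ⟨i, _, by exact_mod_cast Nat.lt_succ_self i, rfl⟩

theorem isLadderCircuit_doubleRay (i : ℕ) : IsLadderCircuit (ladderArc i ⊤) :=
  .inr ⟨i, _, ENat.natCast_lt_top i, rfl⟩

theorem not_ladderMatroid_isBase_ground : ¬ ladderMatroid.IsBase ladderMatroid.E :=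
  fun h => isLadderCircuit_singleton_l.dep.not_indep (h.indep.subset (Set.subset_univ _))

/-- The edges on the bottom side and the rungs form a base. -/
theorem isBase_bottom_rungs : ladderMatroid.IsBase (Set.range q ∪ Set.range r) := by
  refine ladderMatroid_isBase ?_ ?_
  · rintro C (rfl | ⟨i, j, hij, rfl⟩) h
    · simpa using h rfl
    · simpa using h (show p i ∈ _ from ⟨le_rfl, hij⟩)
  · rintro (m | m | m | _) he
    · refine ⟨_, isLadderCircuit_square m, ?_⟩
      rintro (n | n | n | _) hn
      · left
        have h1 := hn.1
        have h2 : n < m + 1 := by exact_mod_cast hn.2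
        rw [show n = m by omega]
      · exact .inr (.inl ⟨n, rfl⟩)
      · exact .inr (.inr ⟨n, rfl⟩)
      · exact hn.elim
    · exact absurd (.inl ⟨m, rfl⟩) he
    · exact absurd (.inr ⟨m, rfl⟩) he
    · exact ⟨_, isLadderCircuit_singleton_l, by simp⟩

/-- The edges on the two sides form a base. -/
theorem isBase_sides : ladderMatroid.IsBase (Set.range p ∪ Set.range q) := by
  refine ladderMatroid_isBase ?_ ?_
  · rintro C (rfl | ⟨i, j, hij, rfl⟩) h
    · simpa using h rfl
    · simpa using h (show r i ∈ _ from .inl rfl)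
  · rintro (m | m | m | _) he
    · exact absurd (.inl ⟨m, rfl⟩) he
    · exact absurd (.inr ⟨m, rfl⟩) he
    · refine ⟨_, isLadderCircuit_doubleRay m, ?_⟩
      rintro (n | n | n | _) hn
      · exact .inr (.inl ⟨n, rfl⟩)
      · exact .inr (.inr ⟨n, rfl⟩)
      · rcases hn with rfl | hn
        · exact .inl rfl
        · exact absurd hn (ENat.natCast_ne_top n)
      · exact hn.elim
    · exact ⟨_, isLadderCircuit_singleton_l, by simp⟩

/-- A base obtained from the edges on the bottom side and the rungs by exchanging a rung. -/
theorem isBase_bottom_rungs_exchange (n : ℕ) :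
    ladderMatroid.IsBase (insert (p n) ((Set.range q ∪ Set.range r) \ {r (n + 1)})) := by
  refine isBase_bottom_rungs.exchange_isBase_of_indep (by simp) ?_
  by_contra hdep
  obtain ⟨C, hC, hCB⟩ := ladderMatroid_not_indep_iff.1 hdep
  rcases hC with rfl | ⟨i, j, hij, rfl⟩
  · simpa using hCB rfl
  · have hp : ∀ m, i ≤ m → (m : ℕ∞) < j → m = n := by
      intro m hm hmj
      simpa using hCB (show p m ∈ _ from ⟨hm, hmj⟩)
    obtain rfl := hp i le_rfl hij
    by_cases hj : ((i + 1 : ℕ) : ℕ∞) < j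
    · have := hp (i + 1) (by omega) hj
      omega
    · have hj' : ((i + 1 : ℕ) : ℕ∞) = j := by
        refine le_antisymm ?_ (not_lt.1 hj)
        rw [Nat.cast_succ]
        exact Order.add_one_le_of_lt hij
      simpa using hCB (show r (i + 1) ∈ _ from .inr hj')

/-- Every base covers every vertex on the top side. -/
theorem exists_mem_isBase_inc_top {B : Set LadderEdge} (hB : ladderMatroid.IsBase B) (n : ℕ) :
    ∃ e ∈ B, e.Inc (.top n) := by
  by_contra! hno
  have hpB : p n ∉ B := fun h => hno _ h (by simp)
  -- The fundamental circuit of `p n` has a second edge at this vertex, and that edge lies in `B`.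
  obtain ⟨C, hC, hCB⟩ := ladderMatroid_not_indep_iff.1 (hB.insert_dep ⟨trivial, hpB⟩).not_indep
  have hpC : p n ∈ C := by
    by_contra hpC
    refine hC.dep.not_indep (hB.indep.subset fun e he => (hCB he).resolve_left ?_)
    rintro rfl
    exact hpC he
  rcases hC with rfl | ⟨i, j, hij, rfl⟩
  · simp at hpC
  · obtain ⟨e, he, hne, hinc⟩ := noLeaf_ladderArc hij _ hpC (by simp) (.top n) (by simp)
    exact hno e ((hCB he).resolve_left hne) hinc

end matroid

/-! ### Thin sums representation of `M⁺` -/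

section thin

open LadderEdge Matroid

/-- Weights of the edges, chosen such that every circuit carries a flow of nonzero total weight. -/
def ladderWeight : LadderEdge → ℚ
  | r m => m + 1
  | l => 1
  | _ => 0

/-- A family whose thin dependences are the flows of total weight zero. -/
def ladderFamily : LadderEdge → (ℕ ⊕ ℕ ⊕ Unit) → ℚ
  -- The coordinates encode, in turn, the cuts `{p n, q n}`, conservation at the top vertices, and
  -- the total weight.
  | p m, .inl n => if m = n then 1 else 0
  | q m, .inl n => if m = n then 1 else 0
  | p m, .inr (.inl n) => if m = n then 1 else if m + 1 = n then -1 else 0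
  | r m, .inr (.inl n) => if m = n then 1 else 0
  | e, .inr (.inr _) => ladderWeight e
  | _, _ => 0

theorem finite_support_and_finsum_eq {α k : Type*} [AddCommMonoid k] {g : α → k}
    (s : Finset α) (h : ∀ a, a ∉ s → g a = 0) :
    {a | g a ≠ 0}.Finite ∧ ∑ᶠ a, g a = ∑ a ∈ s, g a := by
  have hsub : Function.support g ⊆ s := fun a ha => by_contra fun has => ha (h a has)
  exact ⟨s.finite_toSet.subset hsub, finsum_eq_sum_of_support_subset g hsub⟩

/-- Each cut or vertex coordinate is nonzero on at most three edges, so finiteness is a genuine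
condition only for the weight. -/
theorem isThinDependence_ladderFamily_iff {c : LadderEdge → ℚ} :
    IsThinDependence ladderFamily c ↔ (∃ y t, c = ladderFlow y t) ∧
      {e | c e * ladderWeight e ≠ 0}.Finite ∧ ∑ᶠ e, c e * ladderWeight e = 0 := by
  classical
  have h1 : ∀ n, {e | c e * ladderFamily e (.inl n) ≠ 0}.Finite ∧
      ∑ᶠ e, c e * ladderFamily e (.inl n) = c (p n) + c (q n) := by
    intro n
    have := finite_support_and_finsum_eq (g := fun e => c e * ladderFamily e (.inl n))
      {p n, q n} (by
        rintro (m | m | m | _) h <;> simp at h <;> simp [ladderFamily, h])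
    simpa [ladderFamily] using this
  have h2 : {e | c e * ladderFamily e (.inr (.inl 0)) ≠ 0}.Finite ∧
      ∑ᶠ e, c e * ladderFamily e (.inr (.inl 0)) = c (p 0) + c (r 0) := by
    have := finite_support_and_finsum_eq (g := fun e => c e * ladderFamily e (.inr (.inl 0)))
      {p 0, r 0} (by
        rintro (m | m | m | _) h <;> simp at h <;> simp [ladderFamily, h])
    simpa [ladderFamily] using this
  have h3 : ∀ n, {e | c e * ladderFamily e (.inr (.inl (n + 1))) ≠ 0}.Finite ∧
      ∑ᶠ e, c e * ladderFamily e (.inr (.inl (n + 1))) = -c (p n) + (c (p (n + 1)) +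
        c (r (n + 1))) := by
    intro n
    have := finite_support_and_finsum_eq
      (g := fun e => c e * ladderFamily e (.inr (.inl (n + 1))))
      {p n, p (n + 1), r (n + 1)} (by
        rintro (m | m | m | _) h <;> simp at h <;> simp [ladderFamily, h])
    simpa [ladderFamily] using this
  have h4 : ∀ e, ladderFamily e (.inr (.inr ())) = ladderWeight e := by
    rintro (m | m | m | _) <;> rfl
  constructor
  · intro h
    refine ⟨⟨fun n => c (p n), c l, funext ?_⟩, by simpa only [h4] using h (.inr (.inr ()))⟩
    have h2' := h2.2.symm.trans (h _).2
    have h3' := fun n => (h3 n).2.symm.trans (h _).2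
    rintro (m | m | (_ | m) | _) <;> simp only [ladderFlow]
    · linarith [(h1 m).2.symm.trans (h _).2]
    · linarith
    · linarith [h3' m]
  · rintro ⟨⟨y, t, rfl⟩, hw⟩ (n | (_ | n) | n)
    · exact ⟨(h1 n).1, by rw [(h1 n).2]; simp [ladderFlow]⟩
    · exact ⟨h2.1, by rw [h2.2]; simp [ladderFlow]⟩
    · exact ⟨(h3 n).1, by rw [(h3 n).2]; simp [ladderFlow]⟩
    · simpa only [h4] using hw

/-- Every circuit carries a flow of nonzero total weight. -/
theorem IsLadderCircuit.exists_flow {C : Set LadderEdge} (hC : IsLadderCircuit C) :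
    ∃ (y : ℕ → ℚ) (t : ℚ), (∀ e, e ∉ C → ladderFlow y t e = 0) ∧
      {e | ladderFlow y t e * ladderWeight e ≠ 0}.Finite ∧
      ∑ᶠ e, ladderFlow y t e * ladderWeight e ≠ 0 := by
  classical
  rcases hC with rfl | ⟨i, j, hij, rfl⟩
  · have hz : ∀ e, e ∉ ({l} : Set LadderEdge) → ladderFlow (0 : ℕ → ℚ) 1 e = 0 := by
      rintro (m | m | (_ | m) | _) he <;> simp [ladderFlow] at he ⊢
    obtain ⟨h1, h2⟩ := finite_support_and_finsum_eq
      (g := fun e => ladderFlow (0 : ℕ → ℚ) 1 e * ladderWeight e) {l} (by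
        intro e he
        rw [hz e (by simpa using he), zero_mul])
    refine ⟨0, 1, hz, h1, ?_⟩
    rw [h2]
    simp [ladderFlow, ladderWeight]
  · refine ⟨arcFlow ℚ i j, 0, fun e he => ladderFlow_arcFlow_eq_zero hij he, ?_⟩
    cases j with
    -- Only `r i` contributes, giving `-(i + 1)`. Weights `m` in place of `m + 1` would fail for `i
    -- = 0`.
    | top =>
      obtain ⟨h1, h2⟩ := finite_support_and_finsum_eq
        (g := fun e => ladderFlow (arcFlow ℚ i ⊤) 0 e * ladderWeight e) {r i} (by
          rintro (m | m | m | _) he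
          · exact mul_zero _
          · exact mul_zero _
          · rw [ladderFlow_arcFlow_r hij]
            simp at he
            simp [he]
          · exact zero_mul _)
      refine ⟨h1, ?_⟩
      rw [h2, Finset.sum_singleton, ladderFlow_arcFlow_r hij, if_pos rfl]
      simp only [ladderWeight]
      have : (0 : ℚ) ≤ i := Nat.cast_nonneg i
      linarith
    -- The two rungs contribute `-(i + 1)` and `j + 1`, with total `j - i`.
    | coe j =>
      have hij' : i < j := Nat.cast_lt.1 hij
      obtain ⟨h1, h2⟩ := finite_support_and_finsum_eq
        (g := fun e => ladderFlow (arcFlow ℚ i j) 0 e * ladderWeight e) {r i, r j} (by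
          rintro (m | m | m | _) he
          · exact mul_zero _
          · exact mul_zero _
          · rw [ladderFlow_arcFlow_r hij]
            simp at he
            simp [he]
          · exact zero_mul _)
      refine ⟨h1, ?_⟩
      rw [h2, Finset.sum_pair (by simpa using hij'.ne), ladderFlow_arcFlow_r hij,
        ladderFlow_arcFlow_r hij, if_pos rfl, if_neg hij'.ne', if_pos rfl]
      simp only [ladderWeight]
      have : (i : ℚ) < j := Nat.cast_lt.2 hij'
      linarith

theorem isThinSumsOver_of_isPlus_ladderMatroid {N : Matroid LadderEdge}
    (h : ladderMatroid.IsPlus N) : IsThinSumsOver.{0} ℚ N := by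
  refine ⟨_, ladderFamily, fun I _ => ?_⟩
  rw [h.indep_iff (Set.subset_univ I)]
  simp only [ladderMatroid_isCircuit_iff]
  constructor
  · intro huniq c hc hcI
    by_contra! hne
    obtain ⟨e₀, he₀⟩ := hne
    obtain ⟨⟨y, t, rfl⟩, -, hsum⟩ := isThinDependence_ladderFamily_iff.1 hc
    obtain ⟨C, hC, hCy⟩ := exists_isLadderCircuit_of_ladderFlow he₀
    have hCI : C ⊆ I := fun e he => by_contra fun heI => hCy e he (hcI e heI)
    obtain ⟨y', t', hz, hfin', hsum'⟩ := hC.exists_flow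
    have hex : ∃ e, ladderFlow y' t' e ≠ 0 := by
      by_contra! hall
      exact hsum' (by simp [hall])
    obtain ⟨e, he⟩ := hex
    have heC : e ∈ C := by_contra fun heC => he (hz e heC)
    set s := ladderFlow y t e / ladderFlow y' t' e with hs
    have hs0 : s ≠ 0 := div_ne_zero (hCy e heC) he
    -- The factor `s` cancels the value at `e`. The difference is nonzero, since its two terms have
    -- weight zero and nonzero weight respectively.
    have hex' : ∃ f, ladderFlow (y - s • y') (t - s * t') f ≠ 0 := by
      by_contra! hall
      refine mul_ne_zero hs0 hsum' ?_
      rw [mul_finsum', ← hsum]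
      · refine finsum_congr fun f => ?_
        have := hall f
        rw [ladderFlow_sub_smul, sub_eq_zero] at this
        rw [this, mul_assoc]
      · exact hfin'
    obtain ⟨f, hf⟩ := hex'
    obtain ⟨C', hC', hCy'⟩ := exists_isLadderCircuit_of_ladderFlow hf
    have hCI' : C' ⊆ I := by
      intro g hg
      by_contra hgI
      refine hCy' g hg ?_
      rw [ladderFlow_sub_smul, hcI g hgI, hz g fun hgC => hgI (hCI hgC)]
      simp
    refine hCy' e (huniq C C' hC hC' hCI hCI' ▸ heC) ?_
    rw [ladderFlow_sub_smul, hs, div_mul_cancel₀ _ he, sub_self]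
  · intro hind C C' hC hC' hCI hCI'
    obtain ⟨y, t, hz, hfin, hsum⟩ := hC.exists_flow
    obtain ⟨y', t', hz', hfin', hsum'⟩ := hC'.exists_flow
    -- This factor balances the weights. Independence makes the two flows proportional, and a
    -- circuit in the support of the first lies in both `C` and `C'`.
    set s := (∑ᶠ e, ladderFlow y t e * ladderWeight e) /
      ∑ᶠ e, ladderFlow y' t' e * ladderWeight e with hs
    have hs0 : s ≠ 0 := div_ne_zero hsum hsum'
    have hzero := hind (ladderFlow (y - s • y') (t - s * t')) (by
      refine isThinDependence_ladderFamily_iff.2 ⟨⟨_, _, rfl⟩, ?_⟩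
      simp only [ladderFlow_sub_smul, sub_mul, mul_assoc]
      have hfin'' : {e | s * (ladderFlow y' t' e * ladderWeight e) ≠ 0}.Finite :=
        hfin'.subset fun e he => right_ne_zero_of_mul he
      refine ⟨(hfin.union hfin'').subset fun e he => ?_, ?_⟩
      · by_contra hno
        simp only [Set.mem_union, Set.mem_ofPred_eq, not_or, not_not] at hno
        exact he (by rw [hno.1, hno.2, sub_zero])
      · rw [finsum_sub_distrib hfin hfin'', ← mul_finsum' _ _ hfin', hs,
          div_mul_cancel₀ _ hsum', sub_self])
      (fun e he => by
        rw [ladderFlow_sub_smul, hz e fun h => he (hCI h), hz' e fun h => he (hCI' h)]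
        simp)
    simp only [ladderFlow_sub_smul, sub_eq_zero] at hzero
    have hex : ∃ e, ladderFlow y t e ≠ 0 := by
      by_contra! hall
      exact hsum (by simp [hall])
    obtain ⟨e, he⟩ := hex
    obtain ⟨D, hD, hDy⟩ := exists_isLadderCircuit_of_ladderFlow he
    have hDC : D ⊆ C := fun f hf => by_contra fun hfC => hDy f hf (hz f hfC)
    have hDC' : D ⊆ C' := fun f hf => by_contra fun hfC =>
      hDy f hf (by rw [hzero f, hz' f hfC, mul_zero])
    exact (hC.eq_of_subset hD hDC).symm.trans (hC'.eq_of_subset hD hDC')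

end thin

/-! ### The dual of `M⁺` is not a thin sums matroid -/

section dual

open LadderEdge Matroid

theorem ThinlyIndependent.mono {ι A k : Type*} [Field k] {f : ι → A → k} {I J : Set ι}
    (hJ : ThinlyIndependent f J) (hIJ : I ⊆ J) : ThinlyIndependent f I :=
  fun c hc hcI => hJ c hc fun e he => hcI e fun h => he (hIJ h)

theorem IsThinDependence.sum_eq_zero {ι A k : Type*} [Field k] {f : ι → A → k} {c : ι → k}
    (hc : IsThinDependence f c) (s : Finset ι) (hs : ∀ e, e ∉ s → c e = 0) (a : A) :
    ∑ e ∈ s, c e * f e a = 0 := by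
  rw [← (finite_support_and_finsum_eq s fun e he => by rw [hs e he, zero_mul]).2, (hc a).2]

variable {N : Matroid LadderEdge}

theorem dual_indep_of_isPlus (h : ladderMatroid.IsPlus N) {I B : Set LadderEdge} {e : LadderEdge}
    (hB : ladderMatroid.IsBase B) (he : e ∉ B) (hI : Disjoint I (insert e B)) : N✶.Indep I :=
  (h.dual_indep_iff (Set.subset_univ I)).2 ⟨B, e, hB, ⟨trivial, he⟩, hI⟩

/-- The complement is itself a base of `M`, so it cannot contain a base together with a further
element. Returning any one removed element provides that further element, so this set is a circuit
of the dual. -/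
theorem not_dual_indep_top_loop (h : ladderMatroid.IsPlus N) :
    ¬ N✶.Indep (insert l (Set.range p)) := by
  rw [h.dual_indep_iff (Set.subset_univ _)]
  rintro ⟨B, e, hB, he, hdisj⟩
  have hsub : insert e B ⊆ Set.range q ∪ Set.range r := by
    rintro (m | m | m | _) hx
    · exact absurd hx (Set.disjoint_left.1 hdisj (.inr ⟨m, rfl⟩))
    · exact .inl ⟨m, rfl⟩
    · exact .inr ⟨m, rfl⟩
    · exact absurd hx (Set.disjoint_left.1 hdisj (.inl rfl))
  have := hB.eq_of_subset_isBase isBase_bottom_rungs ((Set.subset_insert e B).trans hsub)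
  exact he.2 (this ▸ hsub (Set.mem_insert e B))

theorem dual_indep_top_loop_sdiff (h : ladderMatroid.IsPlus N) {e : LadderEdge}
    (he : e ∈ insert l (Set.range p)) : N✶.Indep (insert l (Set.range p) \ {e}) := by
  refine dual_indep_of_isPlus h (e := e) isBase_bottom_rungs ?_ ?_
  · rcases he with rfl | ⟨m, rfl⟩ <;> simp
  · rw [Set.disjoint_left]
    rintro _ ⟨rfl | ⟨m, rfl⟩, hne⟩ <;> simpa using hne

theorem dual_indep_rungs (h : ladderMatroid.IsPlus N) : N✶.Indep (Set.range r) := by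
  refine dual_indep_of_isPlus h (e := l) isBase_sides (by simp) ?_
  rw [Set.disjoint_left]
  rintro _ ⟨m, rfl⟩
  simp

/-- The base in which `p n` replaces `r (n + 1)` avoids both edges. This later forces the
coefficient of `p n` in the star dependence to be nonzero. -/
theorem dual_indep_pair (h : ladderMatroid.IsPlus N) (n : ℕ) :
    N✶.Indep {r (n + 1), p (n + 1)} := by
  refine dual_indep_of_isPlus h (e := l) (isBase_bottom_rungs_exchange n) (by simp) ?_
  rw [Set.disjoint_left]
  rintro _ (rfl | rfl) <;> simp

theorem not_dual_indep_star (h : ladderMatroid.IsPlus N) (n : ℕ) :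
    ¬ N✶.Indep {e | e.Inc (.top n)} := by
  rw [h.dual_indep_iff (Set.subset_univ _)]
  rintro ⟨B, e, hB, -, hdisj⟩
  obtain ⟨f, hfB, hf⟩ := exists_mem_isBase_inc_top hB n
  exact Set.disjoint_left.1 hdisj hf (.inr hfB)

theorem not_isThinSums_dual_of_isPlus (h : ladderMatroid.IsPlus N) :
    ¬ IsThinSums.{w, u} N✶ := by
  classical
  rintro ⟨k, _, A, f, hf⟩
  replace hf : ∀ I, N✶.Indep I ↔ ThinlyIndependent f I := fun I =>
    hf I (by rw [dual_ground, h.2.1]; exact Set.subset_univ I)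
  -- A nonzero dependence on a circuit has no zero coefficient there, so its thinness passes to the
  -- family `f (p m)`.
  have hfin : ∀ a, {m | f (p m) a ≠ 0}.Finite := by
    have hdep := (hf _).not.1 (not_dual_indep_top_loop h)
    simp only [ThinlyIndependent] at hdep
    push Not at hdep
    obtain ⟨c, hc, hc0, e, he⟩ := hdep
    have hne : ∀ m, c (p m) ≠ 0 := by
      intro m hm
      refine he ((hf _).1 (dual_indep_top_loop_sdiff h (e := p m) (.inr ⟨m, rfl⟩)) c hc ?_ e)
      intro x hx
      by_cases hxm : x = p m
      · rw [hxm, hm]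
      · exact hc0 x fun h' => hx ⟨h', hxm⟩
    intro a
    refine ((hc a).1.preimage (f := p) fun _ _ _ _ => p.inj).subset fun m hm => ?_
    exact mul_ne_zero (hne m) hm
  have hpind : ThinlyIndependent f (Set.range p) :=
    ((hf _).1 (dual_indep_top_loop_sdiff h (.inl rfl))).mono fun e he => by
      obtain ⟨m, rfl⟩ := he
      simp
  have h0 : ∃ b, ∀ a, f (r 0) a = b * f (p 0) a := by
    have hdep := (hf _).not.1 (not_dual_indep_star h 0)
    simp only [ThinlyIndependent] at hdep
    push Not at hdep
    obtain ⟨c, hc, hc0, e, he⟩ := hdep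
    have hc0' : ∀ x, x ≠ p 0 → x ≠ r 0 → c x = 0 := fun x h1 h2 => hc0 x (by
      rw [Set.mem_ofPred_eq, inc_top_iff]; grind)
    have hr : c (r 0) ≠ 0 := fun hr => he (hpind c hc (fun x hx => by
      by_cases hx' : x = r 0
      · rw [hx', hr]
      · exact hc0' x (fun h => hx ⟨_, h.symm⟩) hx') e)
    refine ⟨-c (p 0) / c (r 0), fun a => ?_⟩
    have := hc.sum_eq_zero {p 0, r 0} (fun x hx => by
      simp only [Finset.mem_insert, Finset.mem_singleton, not_or] at hx
      exact hc0' x hx.1 hx.2) a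
    rw [Finset.sum_pair (by simp)] at this
    field_simp
    linear_combination this
  have hsucc : ∀ n, ∃ a b, a ≠ 0 ∧
      ∀ x, f (r (n + 1)) x = a * f (p n) x + b * f (p (n + 1)) x := by
    intro n
    have hdep := (hf _).not.1 (not_dual_indep_star h (n + 1))
    simp only [ThinlyIndependent] at hdep
    push Not at hdep
    obtain ⟨c, hc, hc0, e, he⟩ := hdep
    have hc0' : ∀ x, x ≠ p n → x ≠ p (n + 1) → x ≠ r (n + 1) → c x = 0 := fun x h1 h2 h3 =>
      hc0 x (by rw [Set.mem_ofPred_eq, inc_top_iff]; grind)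
    have hr : c (r (n + 1)) ≠ 0 := fun hr => he (hpind c hc (fun x hx => by
      by_cases hx' : x = r (n + 1)
      · rw [hx', hr]
      · exact hc0' x (fun h => hx ⟨_, h.symm⟩) (fun h => hx ⟨_, h.symm⟩) hx') e)
    have hp : c (p n) ≠ 0 := fun hp => he ((hf _).1 (dual_indep_pair h n) c hc (fun x hx => by
      simp only [Set.mem_insert_iff, Set.mem_singleton_iff, not_or] at hx
      by_cases hx' : x = p n
      · rw [hx', hp]
      · exact hc0' x hx' hx.2 hx.1) e)
    refine ⟨-c (p n) / c (r (n + 1)), -c (p (n + 1)) / c (r (n + 1)),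
      div_ne_zero (neg_ne_zero.2 hp) hr, fun a => ?_⟩
    have := hc.sum_eq_zero {p n, p (n + 1), r (n + 1)} (fun x hx => by
      simp only [Finset.mem_insert, Finset.mem_singleton, not_or] at hx
      exact hc0' x hx.1 hx.2.1 hx.2.2) a
    rw [Finset.sum_insert (by simp), Finset.sum_pair (by simp)] at this
    field_simp
    linear_combination this
  obtain ⟨b₀, h0⟩ := h0
  choose a b ha hab using hsucc
  -- `b' n` is the coefficient of `f (p n)` in `f (r n)`, and `μ` makes it cancel against the `f (p
  -- n)` term of `f (r (n + 1))`.
  let b' : ℕ → k := fun n => n.casesOn b₀ b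
  let μ : ℕ → k := fun n => n.rec 1 fun n x => -(x * b' n) / a n
  have hμ : ∀ n, μ (n + 1) * a n = -(μ n * b' n) := fun n => div_mul_cancel₀ _ (ha n)
  have hpartial : ∀ n x, ∑ m ∈ Finset.range (n + 1), μ m * f (r m) x = μ n * b' n * f (p n) x := by
    intro n x
    induction n with
    | zero => simp [h0, b', μ]
    | succ n ih =>
      rw [Finset.sum_range_succ, ih, hab, show b' (n + 1) = b n from rfl]
      linear_combination f (p n) x * hμ n
  let c : LadderEdge → k
    | r m => μ m
    | _ => 0
  have hc : IsThinDependence f c := by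
    intro x
    -- Beyond `n` all top edges vanish at `x`. The rung `r (n + 1)` still involves `p n`, so the
    -- finite sum must include it.
    obtain ⟨n, hn⟩ := (hfin x).bddAbove
    have hz : ∀ m, n < m → f (p m) x = 0 := fun m hm =>
      by_contra fun hne => absurd (hn hne) (not_le.2 hm)
    obtain ⟨h1, h2⟩ := finite_support_and_finsum_eq (g := fun e => c e * f e x)
      ((Finset.range (n + 1 + 1)).image r) (by
        rintro (m | m | (_ | m) | _) he
        · exact zero_mul _
        · exact zero_mul _
        · simp at he
        · simp at he
          change c (r (m + 1)) * f (r (m + 1)) x = 0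
          rw [hab, hz m (by omega), hz (m + 1) (by omega)]
          ring
        · exact zero_mul _)
    refine ⟨h1, ?_⟩
    rw [h2, Finset.sum_image fun _ _ _ _ => r.inj]
    exact (hpartial (n + 1) x).trans (by rw [hz _ (Nat.lt_succ_self n), mul_zero])
  have := (hf _).1 (dual_indep_rungs h) c hc (by
    rintro (m | m | m | _) he
    · rfl
    · rfl
    · exact absurd ⟨m, rfl⟩ he
    · rfl) (r 0)
  exact one_ne_zero this

end dual

/-! ### Cycles and double rays of the ladder -/

section graph

open LadderEdge LadderVertex

theorem loopedLadder_isLink_iff {e : LadderEdge} {x y : LadderVertex} :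
    loopedLadder.IsLink e x y ↔ e.ends = (x, y) ∨ e.ends = (y, x) := Iff.rfl

theorem inc_iff_of_isLink {e : LadderEdge} {x y z : LadderVertex}
    (h : loopedLadder.IsLink e x y) : e.Inc z ↔ z = x ∨ z = y := by
  rcases h with h | h <;> simp [LadderEdge.Inc, h, or_comm]

theorem eq_of_isLink_l {x y : LadderVertex} (h : loopedLadder.IsLink l x y) : x = y := by
  rcases h with h | h <;> simp only [ends, Prod.mk.injEq] at h <;> rw [← h.1, ← h.2]

/-- A two-way infinite walk without backtracking, that is injective up to periodicity, traverses
a finite cycle or a double ray of the ladder. -/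
theorem exists_range_eq_ladderArc {v : ℤ → LadderVertex} {e : ℤ → LadderEdge}
    (hlink : ∀ i, loopedLadder.IsLink (e i) (v i) (v (i + 1))) (hne : ∀ i, e i ≠ e (i + 1))
    (hv : ∀ i j, v i = v j → e i = e j ∧ e (i - 1) = e (j - 1)) :
    ∃ (i : ℕ) (j : ℕ∞), (i : ℕ∞) < j ∧ Set.range e = ladderArc i j := by
  have hl : ∀ i, e i ≠ l := by
    intro i hi
    have hvi := eq_of_isLink_l (hi ▸ hlink i)
    exact hne i (hv _ _ hvi).1
  have hnb : ∀ i k, (e k).Inc (v (i + 1)) → e k = e i ∨ e k = e (i + 1) := by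
    intro i k hk
    rw [inc_iff_of_isLink (hlink k)] at hk
    rcases hk with hk | hk
    · exact .inr (hv _ _ hk).1.symm
    · left; simpa using (hv _ _ hk).2.symm
  have hleft : ∀ i, (e i).Inc (v (i + 1)) := fun i => (inc_iff_of_isLink (hlink i)).2 (.inr rfl)
  have hright : ∀ i, (e (i + 1)).Inc (v (i + 1)) := fun i =>
    (inc_iff_of_isLink (hlink (i + 1))).2 (.inl rfl)
  have hnoLeaf : NoLeaf (Set.range e) := by
    rintro _ ⟨i, rfl⟩ - x hx
    rw [inc_iff_of_isLink (hlink i)] at hx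
    rcases hx with rfl | rfl
    · have h1 := hne (i - 1)
      have h2 := hleft (i - 1)
      rw [sub_add_cancel] at h1 h2
      exact ⟨_, ⟨i - 1, rfl⟩, h1, h2⟩
    · exact ⟨_, ⟨i + 1, rfl⟩, (hne i).symm, hright i⟩
  obtain ⟨i, j, hij, hsub⟩ := hnoLeaf.exists_ladderArc_subset ⟨0, rfl⟩ (hl 0)
  refine ⟨i, j, hij, Set.Subset.antisymm ?_ hsub⟩
  -- The arc has a second edge at the common vertex; being an edge of the walk, it can only be the
  -- neighbouring one. So the walk never leaves the arc.
  have hstep : ∀ a, e a ∈ ladderArc i j ↔ e (a + 1) ∈ ladderArc i j := by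
    intro a
    constructor
    · intro ha
      obtain ⟨f, hf, hfe, hinc⟩ := noLeaf_ladderArc hij _ ha (hl _) _ (hleft a)
      obtain ⟨b, rfl⟩ := hsub hf
      exact (hnb a b hinc).resolve_left hfe ▸ hf
    · intro ha
      obtain ⟨f, hf, hfe, hinc⟩ := noLeaf_ladderArc hij _ ha (hl _) _ (hright a)
      obtain ⟨b, rfl⟩ := hsub hf
      exact (hnb a b hinc).resolve_right hfe ▸ hf
  obtain ⟨a, ha⟩ := hsub (show r i ∈ ladderArc i j from .inl rfl)
  have hall : ∀ b, e b ∈ ladderArc i j := by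
    intro b
    induction b using Int.inductionOn' (b := a) with
    | zero => exact ha ▸ .inl rfl
    | succ k _ ih => exact (hstep k).1 ih
    | pred k _ ih => exact (hstep (k - 1)).2 (by rwa [sub_add_cancel])
  rintro _ ⟨b, rfl⟩
  exact hall b

theorem isLadderCircuit_of_isDoubleRayEdgeSet {C : Set LadderEdge}
    (hC : loopedLadder.IsDoubleRayEdgeSet C) : IsLadderCircuit C := by
  obtain ⟨v, e, hv, hlink, rfl⟩ := hC
  refine .inr (exists_range_eq_ladderArc hlink (fun i h => ?_) fun i j hij => ?_)
  · have h1 := (inc_iff_of_isLink (hlink (i + 1))).1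
      (h ▸ (inc_iff_of_isLink (hlink i)).2 (.inl rfl))
    rcases h1 with h1 | h1 <;> have := hv h1 <;> omega
  · obtain rfl := hv hij
    exact ⟨rfl, rfl⟩

/-- Only the loop has equal ends, which settles length one. A longer cycle is unrolled to a periodic
walk indexed by `ℤ`, so that cycles and double rays share one argument. -/
theorem isLadderCircuit_of_isFiniteCycleEdgeSet {C : Set LadderEdge}
    (hC : loopedLadder.IsFiniteCycleEdgeSet C) : IsLadderCircuit C := by
  obtain ⟨n, hn, v, e, hv, he, hlink, rfl⟩ := hC
  by_cases h1 : n = 1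
  · subst h1
    have hl : e 0 = l := by
      have h0 := hlink 0
      rw [show (0 + 1 : ZMod 1) = 0 from Subsingleton.elim _ _, loopedLadder_isLink_iff,
        or_self] at h0
      generalize e 0 = f at h0 ⊢
      rcases f with m | m | m | _ <;> simp only [ends, Prod.mk.injEq] at h0 ⊢
      · simpa using h0.1.trans h0.2.symm
      · simpa using h0.1.trans h0.2.symm
      · simpa using h0.1.trans h0.2.symm
    left
    ext f
    constructor
    · rintro ⟨i, rfl⟩
      rw [Subsingleton.elim i 0]
      exact hl
    · rintro rfl
      exact ⟨0, hl⟩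
  · have : Fact (1 < n) := ⟨by omega⟩
    have hrange : Set.range e = Set.range fun i : ℤ => e i := by
      ext f
      constructor
      · rintro ⟨i, rfl⟩
        obtain ⟨i, rfl⟩ := ZMod.intCast_surjective i
        exact ⟨i, rfl⟩
      · rintro ⟨i, rfl⟩
        exact ⟨i, rfl⟩
    rw [hrange]
    refine .inr (exists_range_eq_ladderArc (v := fun i : ℤ => v i) (fun i => ?_) (fun i h => ?_)
      fun i j hij => ?_)
    · have := hlink i
      push_cast
      exact this
    · have := he h
      simp at this
    · have := hv hij
      simp [this]

theorem isDoubleRayEdgeSet_ladderArc (i : ℕ) :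
    loopedLadder.IsDoubleRayEdgeSet (ladderArc i ⊤) := by
  -- Nonnegative indices run along the top, negative ones along the bottom, and the edge at index
  -- `-1` is the rung `r i`.
  refine ⟨fun
    | .ofNat n => top (i + n)
    | .negSucc n => bot (i + n), fun
    | .ofNat n => p (i + n)
    | .negSucc 0 => r i
    | .negSucc (n + 1) => q (i + n), ?_, ?_, ?_⟩
  · rintro (m | m) (n | n) h <;> simp at h
    · rw [h]
    · rw [h]
  · rintro (m | _ | m)
    · exact .inl rfl
    · exact .inr rfl
    · exact .inr rfl
  · ext f
    constructor
    · rcases f with m | m | m | _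
      · rintro ⟨h, -⟩
        exact ⟨.ofNat (m - i), by simp only [LadderEdge.p.injEq]; omega⟩
      · rintro ⟨h, -⟩
        exact ⟨.negSucc (m - i + 1), by simp only [LadderEdge.q.injEq]; omega⟩
      · rintro (rfl | h)
        · exact ⟨.negSucc 0, rfl⟩
        · exact absurd h (ENat.natCast_ne_top m)
      · exact False.elim
    · rintro ⟨n | _ | n, rfl⟩
      · exact ⟨Nat.le_add_right _ _, ENat.natCast_lt_top _⟩
      · exact .inl rfl
      · exact ⟨Nat.le_add_right _ _, ENat.natCast_lt_top _⟩

theorem isFiniteCycleEdgeSet_singleton_l : loopedLadder.IsFiniteCycleEdgeSet {l} :=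
  ⟨1, one_pos, fun _ => star, fun _ => l, Function.injective_of_subsingleton _,
    Function.injective_of_subsingleton _, fun _ => .inl rfl, by simp⟩

theorem isFiniteCycleEdgeSet_ladderArc {i j : ℕ} (hij : i < j) :
    loopedLadder.IsFiniteCycleEdgeSet (ladderArc i j) := by
  obtain ⟨d, rfl⟩ := Nat.exists_eq_add_of_lt hij
  -- With `j = i + d + 1`, the cycle has `2 * d + 4` vertices: rightwards along the top, down `r j`,
  -- leftwards along the bottom, and up `r i`.
  let v : ℕ → LadderVertex := fun m =>
    if m ≤ d + 1 then top (i + m) else bot (i + (2 * d + 3 - m))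
  let e : ℕ → LadderEdge := fun m =>
    if m < d + 1 then p (i + m) else if m = d + 1 then r (i + d + 1)
      else if m < 2 * d + 3 then q (i + (2 * d + 2 - m)) else r i
  have hv₁ : ∀ {m}, m ≤ d + 1 → v m = top (i + m) := fun h => if_pos h
  have hv₂ : ∀ {m}, d + 1 < m → v m = bot (i + (2 * d + 3 - m)) := fun h => if_neg h.not_ge
  have he₁ : ∀ {m}, m < d + 1 → e m = p (i + m) := fun h => if_pos h
  have he₂ : e (d + 1) = r (i + d + 1) := by simp [e]
  have he₃ : ∀ {m}, d + 1 < m → m < 2 * d + 3 → e m = q (i + (2 * d + 2 - m)) := by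
    intro m h h'
    simp only [e]
    rw [if_neg (by omega), if_neg (by omega), if_pos h']
  have he₄ : ∀ {m}, 2 * d + 3 ≤ m → e m = r i := by
    intro m h
    simp only [e]
    rw [if_neg (by omega), if_neg (by omega), if_neg (by omega)]
  have hval : ∀ a : ZMod (2 * d + 4), a.val < 2 * d + 4 := ZMod.val_lt
  refine ⟨2 * d + 4, by omega, fun a => v a.val, fun a => e a.val, ?_, ?_, ?_, ?_⟩
  · intro a b hab
    apply ZMod.val_injective
    have := hval a
    have := hval b
    simp only [v] at hab
    grind
  · intro a b hab
    apply ZMod.val_injective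
    have := hval a
    have := hval b
    simp only [e] at hab
    grind
  · intro a
    have ha := hval a
    have hsucc : (a + 1).val = if a.val + 1 = 2 * d + 4 then 0 else a.val + 1 := by
      have : Fact (1 < 2 * d + 4) := ⟨by omega⟩
      rw [ZMod.val_add, ZMod.val_one]
      split_ifs with h
      · rw [h, Nat.mod_self]
      · exact Nat.mod_eq_of_lt (by omega)
    rw [loopedLadder_isLink_iff]
    simp only [hsucc]
    generalize a.val = m at ha
    rcases lt_trichotomy m (d + 1) with h | rfl | h
    · left
      rw [if_neg (by omega), he₁ h, hv₁ h.le, hv₁ (by omega)]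
      rfl
    · left
      rw [if_neg (by omega), he₂, hv₁ le_rfl, hv₂ (by omega)]
      simp only [ends, Prod.mk.injEq, LadderVertex.top.injEq, LadderVertex.bot.injEq]
      omega
    · right
      by_cases h' : m < 2 * d + 3
      · rw [if_neg (by omega), he₃ h h', hv₂ (by omega), hv₂ h]
        simp only [ends, Prod.mk.injEq, LadderVertex.bot.injEq]
        omega
      · obtain rfl : m = 2 * d + 3 := by omega
        rw [if_pos (by omega), he₄ le_rfl, hv₁ (by omega), hv₂ (by omega)]
        simp [ends]
  · have hex : ∀ m, m < 2 * d + 4 → e m ∈ Set.range fun a : ZMod (2 * d + 4) => e a.val :=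
      fun m hm => ⟨(m : ZMod (2 * d + 4)), by simp only [ZMod.val_natCast_of_lt hm]⟩
    ext f
    constructor
    · rcases f with m | m | m | _
      · rintro ⟨h1, h2⟩
        have h2 : m < i + d + 1 := by exact_mod_cast h2
        convert hex (m - i) (by omega) using 1
        simp only [e]
        grind
      · rintro ⟨h1, h2⟩
        have h2 : m < i + d + 1 := by exact_mod_cast h2
        convert hex (2 * d + 2 - (m - i)) (by omega) using 1
        simp only [e]
        grind
      · rintro (rfl | h)
        · convert hex (2 * d + 3) (by omega) using 1
          simp only [e]
          grind
        · obtain rfl : m = i + d + 1 := by exact_mod_cast h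
          convert hex (d + 1) (by omega) using 1
          simp only [e]
          grind
      · exact False.elim
    · rintro ⟨a, rfl⟩
      have ha := hval a
      generalize a.val = m at ha
      simp only [e]
      split_ifs
      · simp only [p_mem_ladderArc, Nat.cast_lt]; omega
      · exact .inr rfl
      · simp only [q_mem_ladderArc, Nat.cast_lt]; omega
      · exact .inl rfl

theorem isAlgebraicCycleMatroid_ladderMatroid :
    loopedLadder.IsAlgebraicCycleMatroid ladderMatroid := by
  refine ⟨rfl, fun C => ladderMatroid_isCircuit_iff.trans ⟨?_, ?_⟩⟩
  · rintro (rfl | ⟨i, j, hij, rfl⟩)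
    · exact .inl isFiniteCycleEdgeSet_singleton_l
    · cases j with
      | top => exact .inr (isDoubleRayEdgeSet_ladderArc i)
      | coe j => exact .inl (isFiniteCycleEdgeSet_ladderArc (Nat.cast_lt.1 hij))
  · rintro (h | h)
    · exact isLadderCircuit_of_isFiniteCycleEdgeSet h
    · exact isLadderCircuit_of_isDoubleRayEdgeSet h

end graph

/-- Let `G` be the disjoint union of the one-sided infinite ladder and a loop.  Its algebraic cycle
matroid `M` and the matroid `N = M⁺` exist, `N` is a thin sums matroid over `ℚ`, and the dual of `N`
is not a thin sums matroid over any field. -/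
theorem theorem1p3 :
    ∃ M N : Matroid LadderEdge,
      loopedLadder.IsAlgebraicCycleMatroid M ∧ M.IsPlus N ∧
        IsThinSumsOver.{0} ℚ N ∧ ¬ IsThinSums.{w, u} N.dual := by
  obtain ⟨N, hN⟩ := Matroid.exists_isPlus not_ladderMatroid_isBase_ground
  exact ⟨ladderMatroid, N, isAlgebraicCycleMatroid_ladderMatroid, hN,
    isThinSumsOver_of_isPlus_ladderMatroid hN, not_isThinSums_dual_of_isPlus hN⟩
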